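/- All graphs are finite and simple. For a graph $F=(U,E)$, a hypergraph $\mathcal H=(V,\mathcal E)$ contains a Berge-$F$ if there are injections $\psi:U\to V$ and $\varphi:E\to\mathcal E$ such that $\{\psi(u),\psi(v)\}\subseteq\varphi(e)$ for every edge $e=uv\in E$. A hypergraph is linear if any two distinct hyperedges share at most one vertex. Let $\mathrm{ex}^L_r(n,F)$ be the maximum number of hyperedges in an $r$-uniform linear hypergraph on $n$ vertices that contains no Berge-$F$, and let \[\mathrm{thres}^L(F)=\min\{r_0\ge 2:\ \mathrm{ex}^L_r(n,F)=o(n^2)\text{ as } n\to\infty\text{, for every } r\ge r_0\}.\] Theorem. For every graph $F$ with at least one edge, the above minimum exists and $\mathrm{thres}^L(F)=\chi(F)$; in particular $\mathrm{ex}^L_r(n,F)=o(n^2)$ for every fixed $r\ge\chi(F)$. Moreover, for every $r$ with $2\le r<\chi(F)$ and every $n$ there is an $r$-uniform linear hypergraph on $n$ vertices that contains no Berge-$F$ and whose number of hyperedges is $\Omega(n^2)$ as $n\to\infty$. Explicitly, choose distinct vertices $v_{i,j}$ ($0\le i<r$, $0\le j<\lfloor n/r\rfloor$) among the $n$ vertices;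 then the hypergraph with hyperedges $\{v_{0,x},v_{1,x+m},\dots,v_{r-1,x+(r-1)m}\}$, where $0\le x<\lfloor n/(2r)\rfloor$ and $0\le m\le\lfloor n/(2r(r-1))\rfloor$, has these properties. -/

import Mathlib

open Filter Asymptotics

namespace BergeHypergraph

/-- Every hyperedge of `H` has exactly `r` vertices. -/
def IsUniform {V : Type*} (H : Hypergraph V) (r : ℕ) : Prop :=
  ∀ e ∈ H.edgeSet, e.encard = r

/-- Any two distinct hyperedges of `H` share at most one vertex. -/
def IsLinear {V : Type*} (H : Hypergraph V) : Prop :=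
  ∀ e ∈ H.edgeSet, ∀ f ∈ H.edgeSet, e ≠ f → (e ∩ f).Subsingleton

/-- `H` contains a Berge-`F`: there are an injection `ψ` from the vertices of `F` to the vertices
of `H` and an injection `φ` from the edges of `F` to the hyperedges of `H` such that `φ e`
contains the images under `ψ` of both endpoints of `e`, for every edge `e` of `F`. -/
def ContainsBerge {U V : Type*} (F : SimpleGraph U) (H : Hypergraph V) : Prop :=
  ∃ (ψ : U ↪ H.vertexSet) (φ : F.edgeSet ↪ H.edgeSet),
    ∀ (e : F.edgeSet) (u : U), u ∈ (e : Sym2 U) → (ψ u : V) ∈ (φ e : Set V)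

/-- `H` is an `r`-uniform linear hypergraph on the vertex set `{0, …, n - 1}`
which contains no Berge-`F`. -/
def IsAdmissible {U : Type*} (F : SimpleGraph U) (r n : ℕ) (H : Hypergraph (Fin n)) : Prop :=
  H.vertexSet = Set.univ ∧ IsUniform H r ∧ IsLinear H ∧ ¬ ContainsBerge F H

/-- The maximum number of hyperedges in an `r`-uniform linear hypergraph on `n` vertices which
contains no Berge-`F`. (The set of values is finite, as there are finitely many hypergraphs
on `Fin n`.) -/
noncomputable def linearExtremalNumber {U : Type*} (F : SimpleGraph U) (r n : ℕ) : ℕ :=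
  sSup {k : ℕ | ∃ H : Hypergraph (Fin n), IsAdmissible F r n H ∧ H.edgeSet.ncard = k}

/-- As `n → ∞`, the maximum number of hyperedges in an `r`-uniform linear hypergraph on `n`
vertices without a Berge-`F` is `o(n ^ 2)`. -/
def IsSubquadratic {U : Type*} (F : SimpleGraph U) (r : ℕ) : Prop :=
  (fun n : ℕ => (linearExtremalNumber F r n : ℝ)) =o[atTop] (fun n : ℕ => (n : ℝ) ^ 2)

/-- The integers `r₀ ≥ 2` such that the extremal number is `o(n ^ 2)` for all
uniformities `r ≥ r₀`. -/
def linearThresholdSet {U : Type*} (F : SimpleGraph U) : Set ℕ :=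
  {r₀ : ℕ | 2 ≤ r₀ ∧ ∀ r : ℕ, r₀ ≤ r → IsSubquadratic F r}

/-- The linear uniformity threshold of `F`: the least element of `linearThresholdSet F`. -/
noncomputable def linearThreshold {U : Type*} (F : SimpleGraph U) : ℕ :=
  sInf (linearThresholdSet F)

/-- The set of vertices `v_{0,x}, v_{1,x+m}, …, v_{r-1,x+(r-1)m}`, where
`v_{i,j} = i * ⌊n / r⌋ + j` is the `j`-th vertex of the `i`-th block of `⌊n / r⌋` consecutive
vertices in `{0, …, n - 1}`. -/
def progressionEdge (r n x m : ℕ) : Set (Fin n) :=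
  {v : Fin n | ∃ i : ℕ, i < r ∧ (v : ℕ) = i * (n / r) + (x + i * m)}

/-- The hypergraph on `{0, …, n - 1}` whose hyperedges are the progressions
`v_{0,x}, v_{1,x+m}, …, v_{r-1,x+(r-1)m}` with `0 ≤ x < ⌊n / (2r)⌋` and
`0 ≤ m ≤ ⌊n / (2r(r-1))⌋`. -/
def progressionHypergraph (r n : ℕ) : Hypergraph (Fin n) where
  vertexSet := Set.univ
  edgeSet := {e : Set (Fin n) | ∃ x m : ℕ, x < n / (2 * r) ∧ m ≤ n / (2 * r * (r - 1)) ∧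
    e = progressionEdge r n x m}
  subset_vertexSet_of_mem_edgeSet' := fun _ _ => Set.subset_univ _

end BergeHypergraph

/-! Upper bound: in a linear hypergraph a pair of vertices lies in at most one hyperedge, so the
shadow graph is an edge-disjoint union of copies of `K_r`. Regularity reduction loses fewer than `c
* n ^ 2` pairs, so among more than `c * n ^ 2` hyperedges one keeps all its pairs
(`exists_forall_ncard_edgeSet_le`). Its `r` vertices point to `r` parts that are pairwise uniform
and dense, and an `r`-colourable `F` embeds greedily into these parts
(`exists_embedding_of_isUniform`).

For the copy to be a Berge-`F`, distinct edges of `F` must lie in distinct hyperedges; it suffices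
that no hyperedge contains three image vertices. By linearity this forbids only boundedly many
vertices at each step (`NoThreeInEdge.exists_bad`), which linear-sized parts can afford.

Lower bound: each progression meets each of the `r` blocks once, so the block index turns a
Berge-`F` into an `r`-colouring of `F`. Two terms determine a progression, which gives both
linearity and the quadratic count. -/

namespace SimpleGraph

open Finset

/-! ### Pairs lost in the regularity reduction -/

section Unreduced

variable {α : Type*} [Fintype α] [DecidableEq α] {G : SimpleGraph α} [DecidableRel G.Adj]
  {P : Finpartition (univ : Finset α)}

open scoped Classical in
/-- Few pairs of adjacent vertices are lost in the regularity reduction. -/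
lemma card_unreduced_lt [Nonempty α] {ε δ : ℝ} (hε : 0 < ε) (hεδ : ε ≤ δ)
    (hP : P.IsEquipartition) (hPε : P.IsUniform G ε) (hP' : 4 / δ ≤ #P.parts) :
    (#{p : α × α | G.Adj p.1 p.2 ∧ ¬ (G.regularityReduced P ε δ).Adj p.1 p.2} : ℝ)
      < 9 * δ * (Fintype.card α : ℝ) ^ 2 := by
  have hδ : 0 < δ := hε.trans_le hεδ
  -- Lost pairs lie between non-uniform parts, inside a part, or between sparse parts. The bounds `4
  -- * ε`, `δ / 2`, `4 * δ` stay below `9 * δ` because `ε ≤ δ`.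
  let A := (P.nonUniforms G ε).biUnion fun (U, V) ↦ U ×ˢ V
  let B := P.parts.biUnion offDiag
  let C := (P.sparsePairs G δ).biUnion fun (U, V) ↦ G.interedges U V
  have hsub : ({p : α × α | G.Adj p.1 p.2 ∧ ¬ (G.regularityReduced P ε δ).Adj p.1 p.2} :
      Finset (α × α)) ⊆ A ∪ B ∪ C := by
    rintro ⟨x, y⟩ hxy
    simp only [mem_filter, mem_univ, true_and, regularityReduced_adj, not_and, not_exists,
      not_le] at hxy
    obtain ⟨hadj, hred⟩ := hxy
    have hx := P.mem_part (mem_univ x)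
    have hy := P.mem_part (mem_univ y)
    have hX := P.part_mem.2 (mem_univ x)
    have hY := P.part_mem.2 (mem_univ y)
    simp only [A, B, C, mem_union, mem_biUnion, mem_product, mem_offDiag, Prod.exists,
      Finpartition.mk_mem_nonUniforms, Finpartition.mk_mem_sparsePairs, mk_mem_interedges_iff]
    by_cases h1 : P.part x = P.part y
    · exact Or.inl (Or.inr ⟨P.part x, hX, hx, h1 ▸ hy, hadj.ne⟩)
    by_cases h2 : G.IsUniform ε (P.part x) (P.part y)
    · exact Or.inr ⟨_, _, ⟨hX, hY, h1, hred hadj _ hX _ hY hx hy h1 h2⟩, hx, hy, hadj⟩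
    · exact Or.inl (Or.inl ⟨_, _, ⟨hX, hY, h1, h2⟩, hx, hy⟩)
  have hA : (#A : ℝ) < 4 * ε * (#(univ : Finset α) : ℝ) ^ 2 :=
    hP.sum_nonUniforms_lt univ_nonempty hε hPε
  have hB : (#B : ℝ) ≤ δ / 2 * (#(univ : Finset α) : ℝ) ^ 2 := hP.card_biUnion_offDiag_le hδ hP'
  have hC : (#C : ℝ) ≤ 4 * δ * (#(univ : Finset α) : ℝ) ^ 2 :=
    hP.card_interedges_sparsePairs_le hδ.le
  rw [card_univ] at hA hB hC
  have h1 : (#(A ∪ B ∪ C) : ℝ) ≤ #A + #B + #C := by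
    exact_mod_cast (card_union_le _ _).trans (Nat.add_le_add_right (card_union_le _ _) _)
  have h2 := Nat.cast_le (α := ℝ).2 (card_le_card hsub)
  have h3 : ε * (Fintype.card α : ℝ) ^ 2 ≤ δ * (Fintype.card α : ℝ) ^ 2 := by gcongr
  have h4 : 0 ≤ δ * (Fintype.card α : ℝ) ^ 2 := by positivity
  linarith

end Unreduced

/-! ### Greedy embedding into uniform dense families -/

section Embedding

variable {α : Type*} {G : SimpleGraph α} [DecidableRel G.Adj]

/-- In a uniform pair of density at least `δ`, few vertices have a small neighbourhood in a given
large subset of the other side. -/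
lemma IsUniform.card_lowDegree_lt {ε δ : ℝ} {s t s' t' : Finset α} (h : G.IsUniform ε s t)
    (hεδ : ε ≤ δ / 2) (hd : δ ≤ G.edgeDensity s t) (hδ : 0 < δ) (hs' : s' ⊆ s) (ht' : t' ⊆ t)
    (hcard : #t * ε ≤ #t') (hpos : 0 < #s) :
    (#{x ∈ s' | (#{y ∈ t' | G.Adj x y} : ℝ) < δ / 2 * #t'} : ℝ) < #s * ε := by
  by_contra! hX
  set X := {x ∈ s' | (#{y ∈ t' | G.Adj x y} : ℝ) < δ / 2 * #t'} with hXdef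
  have hε := h.pos
  have hXpos : (0 : ℝ) < #X := lt_of_lt_of_le (by positivity) hX
  have hXne : X.Nonempty := card_pos.1 (by exact_mod_cast hXpos)
  -- `X` and `t'` are large enough for uniformity, so their density exceeds `δ - ε ≥ δ / 2`; summing
  -- the low degrees over `X` contradicts this.
  have hdens := h (s' := X) ((filter_subset _ _).trans hs') ht' hX hcard
  have hlow : δ / 2 < (G.edgeDensity X t' : ℝ) := by
    have := (abs_lt.1 hdens).1
    linarith
  have ht'pos : (0 : ℝ) < #t' := by
    obtain ⟨x, hx⟩ := hXne
    have h1 := (mem_filter.1 hx).2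
    have h2 : (0 : ℝ) ≤ #{y ∈ t' | G.Adj x y} := by positivity
    by_contra! h3
    have : δ / 2 * (#t' : ℝ) ≤ 0 := mul_nonpos_of_nonneg_of_nonpos (by positivity) h3
    linarith
  have hcount : #(G.interedges X t') = ∑ x ∈ X, #{y ∈ t' | G.Adj x y} := by
    rw [interedges, Rel.interedges, card_filter, sum_product]
    simp only [card_filter]
  have hsum : (#(G.interedges X t') : ℝ) ≤ #X * (δ / 2 * #t') := by
    rw [hcount, Nat.cast_sum, ← nsmul_eq_mul]
    exact sum_le_card_nsmul _ _ _ fun x hx => (mem_filter.1 hx).2.le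
  rw [← card_interedges_div_card] at hlow
  push_cast at hlow
  rw [lt_div_iff₀ (by positivity)] at hlow
  linarith

/-- **Embedding lemma**: a graph `F` with an `ι`-colouring embeds into a family of large sets which
are pairwise uniform and dense in `G`. The embedding can be chosen so that its image satisfies any
property `I` of finite sets which is preserved by adding all but boundedly many vertices. -/
theorem exists_embedding_of_isUniform [DecidableEq α] {U ι : Type*} [Fintype U] {F : SimpleGraph U}
    (c : F.Coloring ι) {δ ε : ℝ} (hδ : 0 < δ) (hδ1 : δ ≤ 1)
    (hε : 2 * (Fintype.card U + 1) * ε ≤ (δ / 2) ^ (Fintype.card U + 1))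
    (W : ι → Finset α) (hW : ∀ i j, i ≠ j → G.IsUniform ε (W i) (W j))
    (hd : ∀ i j, i ≠ j → δ ≤ G.edgeDensity (W i) (W j))
    (b : ℕ) (hb : ∀ i, 2 * (b : ℝ) < (δ / 2) ^ (Fintype.card U + 1) * #(W i))
    (I : Finset α → Prop) (hI : I ∅)
    (hstep : ∀ T, #T ≤ Fintype.card U → I T →
      ∃ bad : Finset α, #bad ≤ b ∧ T ⊆ bad ∧ ∀ x ∉ bad, I (insert x T)) :
    ∃ ψ : U → α, Function.Injective ψ ∧ (∀ u v, F.Adj u v → G.Adj (ψ u) (ψ v)) ∧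
      I (univ.image ψ) := by
  classical
  set m := Fintype.card U with hm
  rcases isEmpty_or_nonempty U with hU | hU
  · refine ⟨isEmptyElim, fun u => isEmptyElim u, fun u => isEmptyElim u, ?_⟩
    simpa [univ_eq_empty] using hI
  have hWpos : ∀ i, 0 < #(W i) := fun i => by
    by_contra! h
    have := hb i
    have h0 : #(W i) = 0 := by lia
    rw [h0] at this
    have : (0 : ℝ) ≤ b := by positivity
    simp at *
    linarith
  have hpow : ∀ k ≤ m + 1, (δ / 2) ^ (m + 1) ≤ (δ / 2) ^ k := fun k hk =>
    pow_le_pow_of_le_one (by positivity) (by linarith) hk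
  -- the embedding is built one vertex at a time
  have key : ∀ S : Finset U, ∃ ψ : U → α, Set.InjOn ψ S ∧
      (∀ u ∈ S, ∀ v ∈ S, F.Adj u v → G.Adj (ψ u) (ψ v)) ∧ I (S.image ψ) ∧
      ∀ v ∉ S, (δ / 2) ^ #S * #(W (c v)) ≤
        (#{x ∈ W (c v) | ∀ u ∈ S, F.Adj u v → G.Adj (ψ u) x} : ℝ) := by
    intro S
    induction S using Finset.induction_on with
    | empty =>
      obtain ⟨u⟩ := hU
      obtain ⟨x, -⟩ := card_pos.1 (hWpos (c u))
      exact ⟨fun _ => x, by simp, by simp, by simpa using hI, by simp⟩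
    | insert v S hv ih =>
      obtain ⟨ψ, hinj, hadj, hIS, hcand⟩ := ih
      set C : U → Finset α := fun w => {x ∈ W (c w) | ∀ u ∈ S, F.Adj u w → G.Adj (ψ u) x} with hC
      have hSm : #S + 1 ≤ m := by
        rw [← card_insert_of_notMem hv]; exact card_le_univ _
      obtain ⟨bad, hbad, hTbad, hbadI⟩ := hstep (S.image ψ) (card_image_le.trans (by lia)) hIS
      set low : U → Finset α := fun w =>
        {x ∈ C v | (#{y ∈ C w | G.Adj x y} : ℝ) < δ / 2 * #(C w)} with hlow
      set R : Finset U := {w | w ∉ S ∧ F.Adj v w} with hR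
      -- Positivity of `ε` is only available from a uniform pair, hence only when `v` has a
      -- neighbour still to be embedded.
      have hεpos : 0 < ε ∨ R = ∅ := by
        rcases R.eq_empty_or_nonempty with h | ⟨w, hw⟩
        · exact Or.inr h
        · exact Or.inl (hW _ _ (c.valid (mem_filter.1 hw).2.2)).pos
      have hlowcard : ∀ w ∈ R, (#(low w) : ℝ) ≤ #(W (c v)) * ε := by
        intro w hw
        obtain ⟨hwS, hvw⟩ := (mem_filter.1 hw).2
        have hne := c.valid hvw
        have hε0 := (hW _ _ hne).pos
        have hεle : ε ≤ (δ / 2) ^ (m + 1) := by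
          refine le_trans ?_ hε
          have : (0 : ℝ) ≤ m := by positivity
          nlinarith
        refine (IsUniform.card_lowDegree_lt (hW _ _ hne) ?_ (hd _ _ hne) hδ (filter_subset _ _)
          (filter_subset _ _) ?_ (hWpos _)).le
        · exact hεle.trans ((hpow 1 (by lia)).trans (by simp))
        · refine le_trans ?_ (hcand w hwS)
          rw [mul_comm]
          gcongr
          exact hεle.trans (hpow _ (by lia))
      -- `bad` and the sets `low w` together are smaller than `C v`: each of the two contributions
      -- takes at most half of `(δ / 2) ^ (m + 1) * #(W (c v))`, the first strictly less.
      obtain ⟨x, hxC, hxbad, hxlow⟩ : ∃ x ∈ C v, x ∉ bad ∧ ∀ w ∈ R, x ∉ low w := by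
        by_contra! hcon
        have hsub : C v ⊆ bad ∪ R.biUnion low := by
          intro x hx
          by_cases hxb : x ∈ bad
          · exact mem_union_left _ hxb
          · obtain ⟨w, hw, hxw⟩ := hcon x hx hxb
            exact mem_union_right _ (mem_biUnion.2 ⟨w, hw, hxw⟩)
        have h1 : (#(C v) : ℝ) ≤ #bad + ∑ w ∈ R, (#(low w) : ℝ) := by
          exact_mod_cast (card_le_card hsub).trans ((card_union_le _ _).trans
            (Nat.add_le_add_left card_biUnion_le _))
        have h2 : ∑ w ∈ R, (#(low w) : ℝ) ≤ #R * (#(W (c v)) * ε) := by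
          rw [← nsmul_eq_mul]; exact sum_le_card_nsmul _ _ _ hlowcard
        have h3 : (#bad : ℝ) ≤ b := by exact_mod_cast hbad
        have h4 := hcand v hv
        have h5 := hb (c v)
        have h6 : (#R : ℝ) ≤ m := by exact_mod_cast card_le_univ R
        have hWp : (0 : ℝ) < #(W (c v)) := by exact_mod_cast hWpos _
        have h7 : (δ / 2) ^ (m + 1) * (#(W (c v)) : ℝ) ≤ (δ / 2) ^ #S * #(W (c v)) :=
          mul_le_mul_of_nonneg_right (hpow _ (by lia)) hWp.le
        have h8 : #R * (#(W (c v)) * ε) ≤ (δ / 2) ^ (m + 1) * (#(W (c v)) : ℝ) / 2 := by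
          rcases hεpos with h | h
          · have : #R * (#(W (c v)) * ε) ≤ (m + 1) * (#(W (c v)) * ε) := by
              gcongr; linarith
            have := mul_le_mul_of_nonneg_left hε hWp.le
            linarith
          · rw [h]; simp; positivity
        have h9 : (δ / 2) ^ #S * (#(W (c v)) : ℝ) ≤ #(C v) := h4
        linarith
      have hupd : ∀ u ∈ S, Function.update ψ v x u = ψ u := fun u hu =>
        Function.update_of_ne (ne_of_mem_of_not_mem hu hv) _ _
      have himg : S.image (Function.update ψ v x) = S.image ψ := image_congr fun u hu => hupd u hu
      have hxadj := (mem_filter.1 hxC).2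
      refine ⟨Function.update ψ v x, ?_, ?_, ?_, ?_⟩
      · rw [coe_insert, Set.injOn_insert (by simpa using hv)]
        refine ⟨hinj.congr fun u hu => (hupd u hu).symm, ?_⟩
        rw [← coe_image, himg, Function.update_self]
        exact fun h => hxbad (hTbad (by simpa using h))
      · intro u hu w hw huw
        rcases mem_insert.1 hu with rfl | hu' <;> rcases mem_insert.1 hw with rfl | hw'
        · exact (huw.ne rfl).elim
        · rw [Function.update_self, hupd w hw']
          exact (hxadj w hw' huw.symm).symm
        · rw [Function.update_self, hupd u hu']
          exact hxadj u hu' huw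
        · rw [hupd u hu', hupd w hw']
          exact hadj u hu' w hw' huw
      · rw [image_insert, Function.update_self, himg]
        exact hbadI x hxbad
      · intro w hw
        have hwS : w ∉ S := fun h => hw (mem_insert_of_mem h)
        have h1 := hcand w hwS
        rw [card_insert_of_notMem hv, pow_succ]
        by_cases hvw : F.Adj v w
        · have h2 := hxlow w (by simp [hR, hwS, hvw])
          simp only [hlow, mem_filter, hxC, true_and, not_lt] at h2
          have h3 : {y ∈ C w | G.Adj x y} ⊆ {y ∈ W (c w) | ∀ u ∈ insert v S, F.Adj u w →
              G.Adj (Function.update ψ v x u) y} := by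
            intro y hy
            simp only [hC, mem_filter] at hy
            refine mem_filter.2 ⟨hy.1.1, fun u hu huw => ?_⟩
            rcases mem_insert.1 hu with rfl | hu'
            · rw [Function.update_self]; exact hy.2
            · rw [hupd u hu']; exact hy.1.2 u hu' huw
          have h4 := Nat.cast_le (α := ℝ).2 (card_le_card h3)
          have h5 : δ / 2 * ((δ / 2) ^ #S * (#(W (c w)) : ℝ)) ≤ δ / 2 * #(C w) := by
            gcongr
          linarith
        · have h3 : C w ⊆ {y ∈ W (c w) | ∀ u ∈ insert v S, F.Adj u w →
              G.Adj (Function.update ψ v x u) y} := by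
            intro y hy
            simp only [hC, mem_filter] at hy
            refine mem_filter.2 ⟨hy.1, fun u hu huw => ?_⟩
            rcases mem_insert.1 hu with rfl | hu'
            · exact (hvw huw).elim
            · rw [hupd u hu']; exact hy.2 u hu' huw
          have h4 := Nat.cast_le (α := ℝ).2 (card_le_card h3)
          have h5 : (δ / 2) ^ #S * (δ / 2) * (#(W (c w)) : ℝ) ≤ (δ / 2) ^ #S * 1 * #(W (c w)) := by
            gcongr; linarith
          linarith
  obtain ⟨ψ, hinj, hadj, hIψ, -⟩ := key univ
  exact ⟨ψ, fun u v h => hinj (by simp) (by simp) h, fun u v h => hadj u (mem_univ _) v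
    (mem_univ _) h, hIψ⟩

end Embedding

end SimpleGraph

/-! ### The upper bound for linear hypergraphs -/

namespace BergeHypergraph

open Finset

variable {V : Type*}

/-- The graph joining any two distinct vertices which lie in a common hyperedge. -/
def shadow (H : Hypergraph V) : SimpleGraph V where
  Adj x y := x ≠ y ∧ H.Adj x y
  symm.symm _ _ h := ⟨h.1.symm, h.2.symm⟩
  loopless.irrefl _ h := h.1 rfl

/-- No three vertices of `T` lie in a common hyperedge. -/
def NoThreeInEdge (H : Hypergraph V) (T : Finset V) : Prop :=
  ∀ e ∈ H.edgeSet, ∀ x ∈ T, ∀ y ∈ T, ∀ z ∈ T, x ∈ e → y ∈ e → z ∈ e → x = y ∨ x = z ∨ y = z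

lemma IsLinear.eq_of_mem {H : Hypergraph V} (hH : IsLinear H) {e f : Set V} (he : e ∈ H.edgeSet)
    (hf : f ∈ H.edgeSet) {x y : V} (hxy : x ≠ y) (hxe : x ∈ e) (hye : y ∈ e) (hxf : x ∈ f)
    (hyf : y ∈ f) : e = f := by
  by_contra h
  exact hxy (hH e he f hf h ⟨hxe, hxf⟩ ⟨hye, hyf⟩)

/-- In a linear uniform hypergraph, a set without three vertices in a common hyperedge keeps this
property when any vertex outside a small exceptional set is added. -/
lemma NoThreeInEdge.exists_bad [Finite V] [DecidableEq V] {H : Hypergraph V} {r m : ℕ}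
    (hu : IsUniform H r) (hl : IsLinear H) {T : Finset V} (hT : NoThreeInEdge H T) (hm : #T ≤ m) :
    ∃ bad : Finset V, #bad ≤ m + m * m * r ∧ T ⊆ bad ∧
      ∀ x ∉ bad, NoThreeInEdge H (insert x T) := by
  classical
  have := Fintype.ofFinite V
  let D : V × V → Finset V := fun p => {x | ∃ e ∈ H.edgeSet, p.1 ∈ e ∧ p.2 ∈ e ∧ x ∈ e}
  -- By linearity at most one hyperedge passes through the pair `p`, and it contains all of `D p`.
  have hD : ∀ p ∈ T.offDiag, #(D p) ≤ r := by
    intro p hp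
    have hne := (mem_offDiag.1 hp).2.2
    by_cases h : ∃ e ∈ H.edgeSet, p.1 ∈ e ∧ p.2 ∈ e
    · obtain ⟨e, he, h1, h2⟩ := h
      have hsub : (D p : Set V) ⊆ e := by
        intro x hx
        obtain ⟨f, hf, hf1, hf2, hxf⟩ := (mem_filter.1 hx).2
        exact hl.eq_of_mem hf he hne hf1 hf2 h1 h2 ▸ hxf
      have := Set.encard_le_encard hsub
      rw [hu e he, Set.encard_coe_eq_coe_finsetCard] at this
      exact_mod_cast this
    · have : D p = ∅ := by
        refine filter_eq_empty_iff.2 fun x _ => ?_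
        rintro ⟨e, he, h1, h2, -⟩
        exact h ⟨e, he, h1, h2⟩
      simp [this]
  refine ⟨T ∪ T.offDiag.biUnion D, ?_, subset_union_left, ?_⟩
  · refine (card_union_le _ _).trans (add_le_add hm ((card_biUnion_le_card_mul _ _ _ hD).trans ?_))
    gcongr
    rw [offDiag_card]
    exact (Nat.sub_le _ _).trans (Nat.mul_le_mul hm hm)
  · intro x hx e he
    simp only [mem_union, mem_biUnion, not_or, not_exists, not_and] at hx
    have hx' : ∀ a ∈ T, ∀ b ∈ T, a ∈ e → b ∈ e → x ∈ e → a = b := by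
      intro a ha b hb hae hbe hxe
      by_contra hab
      exact hx.2 (a, b) (mem_offDiag.2 ⟨ha, hb, hab⟩)
        (mem_filter.2 ⟨mem_univ _, e, he, hae, hbe, hxe⟩)
    have hT' := hT e he
    intro a ha b hb c hc hae hbe hce
    rcases mem_insert.1 ha with rfl | ha' <;> rcases mem_insert.1 hb with rfl | hb' <;>
      rcases mem_insert.1 hc with rfl | hc'
    any_goals simp
    · exact Or.inr (Or.inr (hx' b hb' c hc' hbe hce hae))
    · exact Or.inr (Or.inl (hx' a ha' c hc' hae hce hbe))
    · exact Or.inl (hx' a ha' b hb' hae hbe hce)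
    · exact hT' a ha' b hb' c hc' hae hbe hce

/-- A copy of `F` in the shadow without three vertices in a common hyperedge is a Berge-`F`. -/
lemma containsBerge_of_shadow {U : Type*} [Fintype U] [DecidableEq V] {F : SimpleGraph U}
    {H : Hypergraph V} (hV : H.vertexSet = Set.univ) {ψ : U → V} (hψ : Function.Injective ψ)
    (hadj : ∀ u v, F.Adj u v → (shadow H).Adj (ψ u) (ψ v))
    (hthree : NoThreeInEdge H (univ.image ψ)) : ContainsBerge F H := by
  have hex : ∀ e : F.edgeSet, ∃ f ∈ H.edgeSet, ∀ u ∈ (e : Sym2 U), ψ u ∈ f := by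
    rintro ⟨e, he⟩
    induction e using Sym2.ind with
    | _ u v =>
      obtain ⟨-, f, hf, hu, hv⟩ := hadj u v he
      refine ⟨f, hf, fun w hw => ?_⟩
      rcases Sym2.mem_iff.1 hw with rfl | rfl <;> assumption
  choose φ hφ hφmem using hex
  refine ⟨⟨fun u => ⟨ψ u, hV ▸ Set.mem_univ _⟩, fun u v h => hψ (congrArg Subtype.val h)⟩,
    ⟨fun e => ⟨φ e, hφ e⟩, ?_⟩, fun e u hu => hφmem e u hu⟩
  -- Two distinct edges of `F` have at least three endpoints in total, which cannot all map into one
  -- hyperedge.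
  intro e f hef
  have hef' : φ e = φ f := congrArg Subtype.val hef
  have hmem : ∀ u ∈ (f : Sym2 U), ψ u ∈ φ e := fun u hu => hef' ▸ hφmem f u hu
  have hmem' := hφmem e
  have h3 : ∀ u v w, ψ u ∈ φ e → ψ v ∈ φ e → ψ w ∈ φ e → u = v ∨ u = w ∨ v = w := by
    intro u v w hu hv hw
    have := hthree (φ e) (hφ e) (ψ u) (by simp) (ψ v) (by simp) (ψ w) (by simp) hu hv hw
    simpa only [hψ.eq_iff] using this
  obtain ⟨e, he⟩ := e
  obtain ⟨f, hf⟩ := f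
  induction e using Sym2.ind with
  | _ a b =>
    induction f using Sym2.ind with
    | _ c d =>
      have hab : a ≠ b := SimpleGraph.Adj.ne he
      have hcd : c ≠ d := SimpleGraph.Adj.ne hf
      have ha := hmem' a (by simp)
      have hb := hmem' b (by simp)
      have hc := hmem c (by simp)
      have hd := hmem d (by simp)
      have h1 := h3 a b c ha hb hc
      have h2 := h3 a b d ha hb hd
      rw [Subtype.mk.injEq, Sym2.eq_iff]
      grind

/-- A linear `r`-uniform hypergraph without a Berge-`F`, where `F` is `r`-colourable, has `o(n ^ 2)`
hyperedges. -/
theorem exists_forall_ncard_edgeSet_le {U : Type*} [Finite U] {F : SimpleGraph U} {r : ℕ}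
    (hF : F.Colorable r) {c : ℝ} (hc : 0 < c) :
    ∃ N : ℕ, ∀ n ≥ N, ∀ H : Hypergraph (Fin n), IsAdmissible F r n H →
      (H.edgeSet.ncard : ℝ) ≤ c * (n : ℝ) ^ 2 := by
  classical
  have := Fintype.ofFinite U
  obtain ⟨col⟩ := hF
  set m := Fintype.card U with hm
  set δ : ℝ := min 1 (c / 9) with hδdef
  have hδ : 0 < δ := by positivity
  have hδ1 : δ ≤ 1 := min_le_left _ _
  have hδc : 9 * δ ≤ c := by
    have : δ ≤ c / 9 := min_le_right _ _
    linarith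
  set p : ℝ := (δ / 2) ^ (m + 1) with hp
  have hp0 : 0 < p := by positivity
  have hpδ : p ≤ δ := by
    calc p ≤ (δ / 2) ^ 1 := pow_le_pow_of_le_one (by positivity) (by linarith) (by lia)
      _ ≤ δ := by rw [pow_one]; linarith
  set ε : ℝ := p / (2 * (m + 1)) with hεdef
  have hε : 0 < ε := by positivity
  have hεp : 2 * (m + 1) * ε = p := by rw [hεdef]; field_simp
  have hεδ : ε ≤ δ := by
    refine le_trans ?_ hpδ
    have : (0 : ℝ) ≤ m := by positivity
    nlinarith
  set b : ℕ := m + m * m * r with hb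
  -- A part with at least `K` vertices outweighs the `b` forbidden ones; the threshold on `n` below
  -- forces every part to be that large.
  obtain ⟨K, hK⟩ := exists_nat_gt (2 * (b : ℝ) / p)
  set l : ℕ := ⌈4 / δ⌉₊ with hl
  refine ⟨K * SzemerediRegularity.bound ε l + l + 1, fun n hn H ⟨hV, hu, hlin, hno⟩ => ?_⟩
  by_contra! hlarge
  have hn0 : 0 < n := by lia
  have : Nonempty (Fin n) := ⟨⟨0, hn0⟩⟩
  set G := shadow H with hG
  obtain ⟨P, hP, hlP, hPb, hPu⟩ := szemeredi_regularity (G := G) (l := l) hε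
    (by rw [Fintype.card_fin]; lia)
  have hfew := SimpleGraph.card_unreduced_lt hε hεδ hP hPu
    ((Nat.le_ceil _).trans (Nat.cast_le.2 hlP))
  rw [Fintype.card_fin] at hfew
  -- some hyperedge survives in the reduced graph
  obtain ⟨e, he, hsurv⟩ : ∃ e ∈ H.edgeSet, ∀ x ∈ e, ∀ y ∈ e, x ≠ y →
      (G.regularityReduced P ε δ).Adj x y := by
    by_contra! hcon
    choose! x hx y hy hxy hred using hcon
    -- Otherwise each hyperedge has a lost pair, and linearity makes the choice of pair injective.
    have hle : H.edgeSet.ncard ≤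
        #{q : Fin n × Fin n | G.Adj q.1 q.2 ∧ ¬ (G.regularityReduced P ε δ).Adj q.1 q.2} := by
      rw [← Set.ncard_coe_finset]
      refine Set.ncard_le_ncard_of_injOn (fun e => (x e, y e)) ?_ ?_ (Set.toFinite _)
      · intro e he
        simp only [coe_filter, mem_univ, true_and, Set.mem_ofPred_eq]
        exact ⟨⟨hxy e he, e, he, hx e he, hy e he⟩, hred e he⟩
      · intro e he f hf hef
        obtain ⟨h1, h2⟩ := Prod.mk.inj hef
        exact hlin.eq_of_mem he hf (hxy e he) (hx e he) (hy e he) (h1 ▸ hx f hf) (h2 ▸ hy f hf)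
    have := Nat.cast_le (α := ℝ).2 hle
    have : 9 * δ * (n : ℝ) ^ 2 ≤ c * (n : ℝ) ^ 2 := by gcongr
    linarith
  obtain ⟨v, hvmem, hvinj⟩ : ∃ v : Fin r → Fin n, (∀ i, v i ∈ e) ∧ Function.Injective v := by
    have hcard : Nat.card e = r := by
      have := hu e he
      rw [Nat.card_coe_set_eq, Set.ncard, this, ENat.toNat_natCast]
    let f := (Finite.equivFinOfCardEq hcard).symm
    exact ⟨fun i => f i, fun i => (f i).2, Subtype.val_injective.comp f.injective⟩
  have hpart : ∀ i j, i ≠ j → G.IsUniform ε (P.part (v i)) (P.part (v j)) ∧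
      δ ≤ G.edgeDensity (P.part (v i)) (P.part (v j)) := by
    intro i j hij
    obtain ⟨-, A, hA, B, hB, hiA, hjB, -, hAB, hd⟩ :=
      hsurv _ (hvmem i) _ (hvmem j) (hvinj.ne hij)
    rw [P.part_eq_of_mem hA hiA, P.part_eq_of_mem hB hjB]
    exact ⟨hAB, hd⟩
  have hsize : ∀ i, 2 * (b : ℝ) < p * #(P.part (v i)) := by
    intro i
    have h1 := hP.average_le_card_part (P.part_mem.2 (mem_univ (v i)))
    rw [card_univ, Fintype.card_fin] at h1
    have h2 : K ≤ n / #P.parts := by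
      rw [Nat.le_div_iff_mul_le (P.parts_nonempty univ_nonempty.ne_empty).card_pos]
      have := Nat.mul_le_mul_left K hPb
      lia
    have h3 : (K : ℝ) ≤ #(P.part (v i)) := by exact_mod_cast h2.trans h1
    rw [div_lt_iff₀' hp0] at hK
    exact hK.trans_le (by gcongr)
  obtain ⟨ψ, hinj, hadj, hthree⟩ := SimpleGraph.exists_embedding_of_isUniform col hδ hδ1 hεp.le
    (fun i => P.part (v i)) (fun i j hij => (hpart i j hij).1) (fun i j hij => (hpart i j hij).2)
    b hsize (NoThreeInEdge H) (by simp [NoThreeInEdge])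
    (fun T hTm hT => hT.exists_bad hu hlin hTm)
  exact hno (containsBerge_of_shadow hV hinj hadj hthree)

lemma bddAbove_admissible {U : Type*} (F : SimpleGraph U) (r n : ℕ) :
    BddAbove {k : ℕ | ∃ H : Hypergraph (Fin n), IsAdmissible F r n H ∧ H.edgeSet.ncard = k} := by
  refine ⟨Nat.card (Set (Fin n)), ?_⟩
  rintro k ⟨H, -, rfl⟩
  rw [← Set.ncard_univ]
  exact Set.ncard_le_ncard (Set.subset_univ _) (Set.toFinite _)

theorem isSubquadratic_of_colorable {U : Type*} [Finite U] {F : SimpleGraph U} {r : ℕ}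
    (hF : F.Colorable r) : IsSubquadratic F r := by
  refine isLittleO_iff.2 fun c hc => ?_
  obtain ⟨N, hN⟩ := exists_forall_ncard_edgeSet_le hF hc
  filter_upwards [eventually_ge_atTop N] with n hn
  rw [Real.norm_of_nonneg (by positivity), Real.norm_of_nonneg (by positivity)]
  -- Without admissible hypergraphs, as when `F` is edgeless with at most `n` vertices, the supremum
  -- is `0` by default.
  rcases Set.eq_empty_or_nonempty
    {k : ℕ | ∃ H : Hypergraph (Fin n), IsAdmissible F r n H ∧ H.edgeSet.ncard = k} with h | h
  · rw [linearExtremalNumber, h, csSup_empty]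
    simp only [bot_eq_zero, Nat.cast_zero]
    positivity
  · obtain ⟨H, hH, hcard⟩ := Nat.sSup_mem h (bddAbove_admissible F r n)
    rw [linearExtremalNumber, ← hcard]
    exact hN n hn H hH

end BergeHypergraph

namespace BergeHypergraph

/-! ### The progression construction -/

section Progression

variable {r n : ℕ}

/-- The ranges of `x` and `m` are chosen so that the start and the total shift each use at most half
of a block. -/
lemma add_pred_mul_lt_div {x m : ℕ} (hx : x < n / (2 * r))
    (hm : m ≤ n / (2 * r * (r - 1))) : x + (r - 1) * m < n / r := by
  have h1 : (r - 1) * m ≤ n / (2 * r) := by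
    rw [← Nat.div_div_eq_div_mul] at hm
    exact (Nat.mul_le_mul_left _ hm).trans (Nat.mul_div_le _ _)
  have h2 : 2 * (n / (2 * r)) ≤ n / r := by
    rw [mul_comm 2 r, ← Nat.div_div_eq_div_mul]
    exact Nat.mul_div_le _ _
  lia

/-- The `i`-th vertex of a progression stays in the `i`-th block. -/
lemma progression_offset_lt {x m i : ℕ} (hr : 2 ≤ r) (hx : x < n / (2 * r))
    (hm : m ≤ n / (2 * r * (r - 1))) (hi : i < r) : x + i * m < n / r := by
  have h1 := add_pred_mul_lt_div hx hm
  have h2 : i * m ≤ (r - 1) * m := Nat.mul_le_mul_right _ (by lia)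
  lia

lemma progression_val_lt {x m i : ℕ} (hr : 2 ≤ r) (hx : x < n / (2 * r))
    (hm : m ≤ n / (2 * r * (r - 1))) (hi : i < r) : i * (n / r) + (x + i * m) < n := by
  have h1 := progression_offset_lt hr hx hm hi
  have h2 : (i + 1) * (n / r) ≤ r * (n / r) := Nat.mul_le_mul_right _ (by lia)
  have h3 := Nat.mul_div_le n r
  lia

lemma block_unique {q i j a b : ℕ} (ha : a < q) (hb : b < q) (h : i * q + a = j * q + b) :
    i = j ∧ a = b := by
  have hq : 0 < q := by lia
  have h1 : i = (i * q + a) / q := by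
    rw [add_comm, Nat.add_mul_div_right _ _ hq, Nat.div_eq_of_lt ha, zero_add]
  have h2 : j = (j * q + b) / q := by
    rw [add_comm, Nat.add_mul_div_right _ _ hq, Nat.div_eq_of_lt hb, zero_add]
  have hij : i = j := by rw [h1, h2, h]
  subst hij
  exact ⟨rfl, by lia⟩

/-- Distinct vertices of a progression lie in distinct blocks `i ≠ j`. Their offsets `x + i * m` and
`x + j * m` form a linear system whose difference determines `m`, and then `x`. -/
lemma progressionEdge_eq_of_two_mem {x m x' m' : ℕ} (hr : 2 ≤ r) (hx : x < n / (2 * r))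
    (hm : m ≤ n / (2 * r * (r - 1))) (hx' : x' < n / (2 * r)) (hm' : m' ≤ n / (2 * r * (r - 1)))
    {v w : Fin n} (hvw : v ≠ w) (hv : v ∈ progressionEdge r n x m)
    (hw : w ∈ progressionEdge r n x m) (hv' : v ∈ progressionEdge r n x' m')
    (hw' : w ∈ progressionEdge r n x' m') : x = x' ∧ m = m' := by
  obtain ⟨i, hi, hvi⟩ := hv
  obtain ⟨j, hj, hwj⟩ := hw
  obtain ⟨i', hi', hvi'⟩ := hv'
  obtain ⟨j', hj', hwj'⟩ := hw'
  obtain ⟨rfl, h1⟩ := block_unique (progression_offset_lt hr hx hm hi)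
    (progression_offset_lt hr hx' hm' hi') (hvi.symm.trans hvi')
  obtain ⟨rfl, h2⟩ := block_unique (progression_offset_lt hr hx hm hj)
    (progression_offset_lt hr hx' hm' hj') (hwj.symm.trans hwj')
  have hij : i ≠ j := by
    rintro rfl
    exact hvw (Fin.ext (hvi.trans hwj.symm))
  have hmm : m = m' := by
    zify at h1 h2 ⊢
    have h : ((i : ℤ) - j) * (m - m') = 0 := by linear_combination h1 - h2
    rcases mul_eq_zero.1 h with h | h
    · exact absurd (by exact_mod_cast sub_eq_zero.1 h) hij
    · exact sub_eq_zero.1 h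
  subst hmm
  exact ⟨by lia, rfl⟩

/-- The `i`-th vertex of a progression. -/
def progressionVertex {x m : ℕ} (hr : 2 ≤ r) (hx : x < n / (2 * r))
    (hm : m ≤ n / (2 * r * (r - 1))) (i : Fin r) : Fin n :=
  ⟨i * (n / r) + (x + i * m), progression_val_lt hr hx hm i.2⟩

lemma progressionVertex_injective {x m : ℕ} (hr : 2 ≤ r) (hx : x < n / (2 * r))
    (hm : m ≤ n / (2 * r * (r - 1))) : Function.Injective (progressionVertex hr hx hm) :=
  fun i j h => Fin.ext (block_unique (progression_offset_lt hr hx hm i.2)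
    (progression_offset_lt hr hx hm j.2) (congrArg Fin.val h)).1

lemma progressionEdge_eq_range {x m : ℕ} (hr : 2 ≤ r) (hx : x < n / (2 * r))
    (hm : m ≤ n / (2 * r * (r - 1))) :
    progressionEdge r n x m = Set.range (progressionVertex hr hx hm) := by
  ext v
  constructor
  · rintro ⟨i, hi, hv⟩
    exact ⟨⟨i, hi⟩, Fin.ext hv.symm⟩
  · rintro ⟨i, rfl⟩
    exact ⟨i, i.2, rfl⟩

lemma isUniform_progressionHypergraph (hr : 2 ≤ r) (n : ℕ) :
    IsUniform (progressionHypergraph r n) r := by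
  rintro _ ⟨x, m, hx, hm, rfl⟩
  rw [progressionEdge_eq_range hr hx hm, ← Set.image_univ,
    (progressionVertex_injective hr hx hm).encard_image, Set.encard_univ]
  simp

lemma isLinear_progressionHypergraph (hr : 2 ≤ r) (n : ℕ) :
    IsLinear (progressionHypergraph r n) := by
  rintro _ ⟨x, m, hx, hm, rfl⟩ _ ⟨x', m', hx', hm', rfl⟩ hne v ⟨hv, hv'⟩ w ⟨hw, hw'⟩
  by_contra hvw
  obtain ⟨rfl, rfl⟩ := progressionEdge_eq_of_two_mem hr hx hm hx' hm' hvw hv hw hv' hw'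
  exact hne rfl

/-- Every hyperedge has its vertices in different blocks, so a Berge-`F` yields a colouring. -/
lemma colorable_of_containsBerge {U : Type*} {F : SimpleGraph U} (hr : 2 ≤ r)
    (h : ContainsBerge F (progressionHypergraph r n)) : F.Colorable r := by
  obtain ⟨ψ, φ, hφ⟩ := h
  -- The colour is the block index. The reduction `% r` matters only for vertices past the last
  -- block, which lie in no hyperedge.
  refine ⟨SimpleGraph.Coloring.mk
    (fun u => (⟨((ψ u : Fin n) : ℕ) / (n / r) % r, Nat.mod_lt _ (by lia)⟩ : Fin r)) ?_⟩
  intro u v huv heq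
  obtain ⟨x, m, hx, hm, he⟩ := (φ ⟨s(u, v), huv⟩).2
  have hu := hφ ⟨s(u, v), huv⟩ u (by simp)
  have hv := hφ ⟨s(u, v), huv⟩ v (by simp)
  rw [he] at hu hv
  have hblock : ∀ w : Fin n, w ∈ progressionEdge r n x m →
      ∃ i < r, (w : ℕ) / (n / r) % r = i ∧ (w : ℕ) = i * (n / r) + (x + i * m) := by
    rintro w ⟨i, hi, hw⟩
    have hlt := progression_offset_lt hr hx hm hi
    refine ⟨i, hi, ?_, hw⟩
    rw [hw, add_comm, Nat.add_mul_div_right _ _ (by lia), Nat.div_eq_of_lt hlt, zero_add,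
      Nat.mod_eq_of_lt hi]
  obtain ⟨i, -, hiu, hui⟩ := hblock _ hu
  obtain ⟨j, -, hjv, hvj⟩ := hblock _ hv
  have hij : i = j := by
    rw [← hiu, ← hjv]
    exact congrArg Fin.val heq
  subst hij
  exact huv.ne (ψ.injective (Subtype.ext (Fin.ext (hui.trans hvj.symm))))

theorem isAdmissible_progressionHypergraph {U : Type*} {F : SimpleGraph U} (hr : 2 ≤ r)
    (hF : ¬ F.Colorable r) (n : ℕ) : IsAdmissible F r n (progressionHypergraph r n) :=
  ⟨rfl, isUniform_progressionHypergraph hr n, isLinear_progressionHypergraph hr n,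
    fun h => hF (colorable_of_containsBerge hr h)⟩

lemma le_ncard_progressionHypergraph (hr : 2 ≤ r) (n : ℕ) :
    n / (2 * r) * (n / (2 * r * (r - 1)) + 1) ≤ (progressionHypergraph r n).edgeSet.ncard := by
  have hcard : (Finset.range (n / (2 * r)) ×ˢ
      Finset.range (n / (2 * r * (r - 1)) + 1)).card =
      n / (2 * r) * (n / (2 * r * (r - 1)) + 1) := by simp
  rw [← hcard, ← Set.ncard_coe_finset]
  refine Set.ncard_le_ncard_of_injOn (fun p => progressionEdge r n p.1 p.2) ?_ ?_ (Set.toFinite _)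
  · rintro ⟨x, m⟩ hp
    simp only [Finset.coe_product, Finset.coe_range, Set.mem_prod, Set.mem_Iio] at hp
    exact ⟨x, m, hp.1, by lia, rfl⟩
  · rintro ⟨x, m⟩ hp ⟨x', m'⟩ hp' heq
    simp only [Finset.coe_product, Finset.coe_range, Set.mem_prod, Set.mem_Iio] at hp hp'
    have hm : m ≤ n / (2 * r * (r - 1)) := by lia
    have hm' : m' ≤ n / (2 * r * (r - 1)) := by lia
    have heq : progressionEdge r n x m = progressionEdge r n x' m' := heq
    have hmem : ∀ i, progressionVertex hr hp.1 hm i ∈ progressionEdge r n x m := fun i =>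
      progressionEdge_eq_range hr hp.1 hm ▸ Set.mem_range_self i
    have hne : progressionVertex hr hp.1 hm ⟨0, by lia⟩ ≠
        progressionVertex hr hp.1 hm ⟨1, by lia⟩ :=
      (progressionVertex_injective hr hp.1 hm).ne (by simp)
    obtain ⟨rfl, rfl⟩ := progressionEdge_eq_of_two_mem hr hp.1 hm hp'.1 hm' hne (hmem _) (hmem _)
      (heq ▸ hmem _) (heq ▸ hmem _)
    rfl

theorem exists_le_ncard_progressionHypergraph (hr : 2 ≤ r) :
    ∃ c : ℝ, 0 < c ∧ ∀ᶠ n : ℕ in atTop,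
      c * (n : ℝ) ^ 2 ≤ ((progressionHypergraph r n).edgeSet.ncard : ℝ) := by
  set A := 2 * r with hA
  set B := 2 * r * (r - 1) with hB
  have hA0 : 0 < A := by lia
  have hB0 : 0 < B := Nat.mul_pos hA0 (by lia)
  -- The factor `2` absorbs the rounding in `n / A`; the inclusive range of `m` gives `n / B + 1`
  -- choices, so nothing is lost there.
  refine ⟨1 / (2 * A) * (1 / B), by positivity, ?_⟩
  filter_upwards [eventually_ge_atTop (2 * A)] with n hn
  have h1 : (n : ℝ) ≤ 2 * A * (n / A : ℕ) := by
    have hmod := Nat.div_add_mod n A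
    have := Nat.mod_lt n hA0
    have : n ≤ 2 * (A * (n / A)) := by lia
    rw [mul_assoc]
    exact_mod_cast this
  have h2 : (n : ℝ) ≤ B * ((n / B : ℕ) + 1) := by
    exact_mod_cast (Nat.lt_mul_div_succ n hB0).le
  have h3 : ((n / A : ℕ) : ℝ) * ((n / B : ℕ) + 1) ≤
      ((progressionHypergraph r n).edgeSet.ncard : ℝ) := by
    exact_mod_cast le_ncard_progressionHypergraph hr n
  refine le_trans ?_ h3
  calc 1 / (2 * A) * (1 / B) * (n : ℝ) ^ 2 = (n / (2 * A)) * (n / B) := by field_simp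
    _ ≤ _ := by
      gcongr
      · rwa [div_le_iff₀' (by positivity)]
      · rwa [div_le_iff₀' (by positivity)]

end Progression

theorem not_isSubquadratic_of_not_colorable {U : Type*} {F : SimpleGraph U} {r : ℕ} (hr : 2 ≤ r)
    (hF : ¬ F.Colorable r) : ¬ IsSubquadratic F r := by
  intro h
  obtain ⟨c, hc, hlow⟩ := exists_le_ncard_progressionHypergraph hr
  have hup := isLittleO_iff.1 h (half_pos hc)
  obtain ⟨n, h1, h2, hn⟩ := (hlow.and (hup.and (eventually_gt_atTop 0))).exists
  rw [Real.norm_of_nonneg (by positivity), Real.norm_of_nonneg (by positivity)] at h2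
  have h3 : (progressionHypergraph r n).edgeSet.ncard ≤ linearExtremalNumber F r n :=
    le_csSup (bddAbove_admissible F r n) ⟨_, isAdmissible_progressionHypergraph hr hF n, rfl⟩
  have h4 := Nat.cast_le (α := ℝ).2 h3
  have h5 : 0 < c * (n : ℝ) ^ 2 := by positivity
  linarith

end BergeHypergraph

/-! ### The threshold equals the chromatic number -/

theorem theorem4 {U : Type*} [Finite U] (F : SimpleGraph U) (hF : F.edgeSet.Nonempty) :
    -- the minimum defining the threshold exists, and it equals the chromatic number
    (IsLeast (BergeHypergraph.linearThresholdSet F) (BergeHypergraph.linearThreshold F) ∧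
      (BergeHypergraph.linearThreshold F : ℕ∞) = F.chromaticNumber) ∧
    -- below the chromatic number: an explicit construction with `Ω(n ^ 2)` hyperedges
    (∀ r : ℕ, 2 ≤ r → (r : ℕ∞) < F.chromaticNumber →
      (∀ n : ℕ, BergeHypergraph.IsAdmissible F r n (BergeHypergraph.progressionHypergraph r n)) ∧
      ∃ c : ℝ, 0 < c ∧ ∀ᶠ n : ℕ in atTop,
        c * (n : ℝ) ^ 2 ≤ ((BergeHypergraph.progressionHypergraph r n).edgeSet.ncard : ℝ)) ∧
    -- from the chromatic number on: `o(n ^ 2)` hyperedges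
    (∀ r : ℕ, F.chromaticNumber ≤ (r : ℕ∞) → BergeHypergraph.IsSubquadratic F r) := by
  have hcol : ∀ r : ℕ, F.chromaticNumber ≤ (r : ℕ∞) ↔ F.Colorable r := fun r =>
    SimpleGraph.chromaticNumber_le_iff_colorable
  have := Fintype.ofFinite U
  obtain ⟨k, hk⟩ : ∃ k : ℕ, F.chromaticNumber = k :=
    (ENat.ne_top_iff_exists.1 (SimpleGraph.chromaticNumber_ne_top_iff_exists.2
      ⟨_, F.colorable_of_fintype⟩)).imp fun _ h => h.symm
  have hsub : ∀ r : ℕ, F.chromaticNumber ≤ (r : ℕ∞) → BergeHypergraph.IsSubquadratic F r :=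
    fun r hr => BergeHypergraph.isSubquadratic_of_colorable ((hcol r).1 hr)
  -- Here an edge of `F` is needed: the threshold is at least `2` by definition, while an edgeless
  -- graph has chromatic number at most `1`.
  have hk2 : 2 ≤ k := by
    obtain ⟨e, he⟩ := hF
    induction e using Sym2.ind with
    | _ u v =>
      have := SimpleGraph.two_le_chromaticNumber_of_adj (G := F) he
      rw [hk] at this
      exact_mod_cast this
  have hleast : IsLeast (BergeHypergraph.linearThresholdSet F) k := by
    refine ⟨⟨hk2, fun r hr => hsub r (by rw [hk]; exact_mod_cast hr)⟩, fun r₀ ⟨h2, hr₀⟩ => ?_⟩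
    by_contra! hlt
    refine BergeHypergraph.not_isSubquadratic_of_not_colorable h2 (fun h => ?_) (hr₀ r₀ le_rfl)
    have := (hcol r₀).2 h
    rw [hk] at this
    exact absurd (by exact_mod_cast this : k ≤ r₀) (by lia)
  have hthr : BergeHypergraph.linearThreshold F = k := hleast.csInf_eq
  refine ⟨⟨hthr ▸ hleast, by rw [hthr, hk]⟩, fun r hr hlt => ⟨fun n => ?_, ?_⟩, hsub⟩
  · exact BergeHypergraph.isAdmissible_progressionHypergraph hr
      (fun h => ((hcol r).2 h).not_gt hlt) n
  · exact BergeHypergraph.exists_le_ncard_progressionHypergraph hr
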